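/- Let $\mathcal H$ be a separable complex Hilbert space and let $H_0,\dots,H_N$ ($N\ge 0$) be selfadjoint, possibly unbounded, operators on $\mathcal H$. Let $D\subseteq\mathcal H$ be a linear subspace that is contained in the domain of every $H_j$ and on which every $H_j$ is essentially selfadjoint, i.e. $H_j$ is the closure of its restriction to $D$, $j=0,\dots,N$ (for instance, each $H_j$ has domain $D$, or $H_0$ has domain $D$ and $H_1,\dots,H_N$ are bounded). Assume that for every $\mathbf y=(y_1,\dots,y_N)\in\mathbb R^N$ the operator $$H(\mathbf y)=H_0+\sum_{j=1}^N y_jH_j,$$ defined on the domain $D$, is selfadjoint. Let $\mathrm U(\mathcal H)$ be the group of unitary operators with the strong operator topology. Let the dynamical group $\mathcal G$ be the smallest strongly closed subgroup of $\mathrm U(\mathcal H)$ containing all $\exp(itH(\mathbf y))$ with $t\in\mathbb R$, $\mathbf y\in\mathbb R^N$, and let the restricted dynamical group $\hat{\mathcal G}$ be the smallest strongly closed subgroup of $\mathrm U(\mathcal H)$ containing all $\exp(itH_j)$ with $t\in\mathbb R$, $j=0,\dots,N$. Then $\hat{\mathcal G}=\mathcal G$. -/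

import Mathlib

/-! Strongly continuous unitary groups, strongly closed subgroups of the unitary group, and the two
groups attached to a bilinear control system with unbounded Hamiltonians. -/

namespace QControl

variable {E : Type*} [NormedAddCommGroup E] [InnerProductSpace ℂ E] [CompleteSpace E]

/-- The group `U(ℋ)` of unitary operators on `ℋ`. -/
noncomputable abbrev UnitaryGroup (E : Type*) [NormedAddCommGroup E] [InnerProductSpace ℂ E]
    [CompleteSpace E] := unitary (E →L[ℂ] E)

/-- `U` is the strongly continuous one-parameter unitary group with infinitesimal generator
`i A`: a vector `x` lies in the domain of `A`, with `A x = y`, if and only if `t ↦ U t x` is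
differentiable at `0` with derivative `i y`. -/
structure IsUnitaryGroupOf (A : E →ₗ.[ℂ] E) (U : ℝ → UnitaryGroup E) : Prop where
  map_zero : U 0 = 1
  map_add : ∀ s t : ℝ, U (s + t) = U s * U t
  continuous : ∀ x : E, Continuous fun t : ℝ => (U t : E →L[ℂ] E) x
  generator : ∀ x y : E, (x, y) ∈ A.graph ↔
    HasDerivAt (fun t : ℝ => (U t : E →L[ℂ] E) x) (Complex.I • y) 0

/-- The orbit of a vector of the domain solves `ψ' = i A ψ`. -/
theorem IsUnitaryGroupOf.hasDerivAt {A : E →ₗ.[ℂ] E} {U : ℝ → UnitaryGroup E}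
    (hU : IsUnitaryGroupOf A U) {x y : E} (hxy : (x, y) ∈ A.graph) (t : ℝ) :
    ((U t : E →L[ℂ] E) x, (U t : E →L[ℂ] E) y) ∈ A.graph ∧
      HasDerivAt (fun s : ℝ => (U s : E →L[ℂ] E) x)
        (Complex.I • (U t : E →L[ℂ] E) y) t := by
  have h0 := (hU.generator x y).1 hxy
  have h1 : HasDerivAt (fun s : ℝ => (U t : E →L[ℂ] E) ((U s : E →L[ℂ] E) x))
      ((U t : E →L[ℂ] E) (Complex.I • y)) 0 :=
    ((U t : E →L[ℂ] E).restrictScalars ℝ).hasFDerivAt.comp_hasDerivAt 0 h0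
  rw [map_smul] at h1
  constructor
  · rw [hU.generator]
    refine h1.congr_of_eventuallyEq (Filter.Eventually.of_forall fun s => ?_)
    have : U s * U t = U t * U s := by rw [← hU.map_add, ← hU.map_add, add_comm]
    exact congrArg (fun V : UnitaryGroup E => (V : E →L[ℂ] E) x) this
  · have h2 : HasDerivAt (fun s : ℝ => (U t : E →L[ℂ] E) ((U (s - t) : E →L[ℂ] E) x))
        (Complex.I • (U t : E →L[ℂ] E) y) t := by
      have h1' := h1
      rw [← sub_self t] at h1'
      exact h1'.comp_sub_const t t
    refine h2.congr_of_eventuallyEq (Filter.Eventually.of_forall fun s => ?_)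
    have : U s = U t * U (s - t) := by rw [← hU.map_add]; congr 1; ring
    exact congrArg (fun V : UnitaryGroup E => (V : E →L[ℂ] E) x) this

/-- A selfadjoint operator determines its one-parameter group. -/
theorem IsUnitaryGroupOf.unique {A : E →ₗ.[ℂ] E} (hA : IsSelfAdjoint A)
    {U V : ℝ → UnitaryGroup E} (hU : IsUnitaryGroupOf A U) (hV : IsUnitaryGroupOf A V) :
    U = V := by
  have hsym : ∀ {a b c d : E}, (a, b) ∈ A.graph → (c, d) ∈ A.graph →
      inner ℂ b c = inner ℂ a d := by
    intro a b c d hab hcd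
    have h := LinearPMap.adjoint_isFormalAdjoint (T := A) hA.dense_domain
    rw [LinearPMap.isSelfAdjoint_def.1 hA] at h
    obtain ⟨a', rfl, rfl⟩ := (LinearPMap.mem_graph_iff A).1 hab
    obtain ⟨c', rfl, rfl⟩ := (LinearPMap.mem_graph_iff A).1 hcd
    exact h a' c'
  have key : ∀ x ∈ (A.domain : Set E), ∀ t : ℝ,
      (U t : E →L[ℂ] E) x = (V t : E →L[ℂ] E) x := by
    intro x hx t
    have hxy : (x, A ⟨x, hx⟩) ∈ A.graph := LinearPMap.mem_graph A ⟨x, hx⟩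
    have hd : ∀ s : ℝ, HasDerivAt
        (fun s : ℝ => inner ℂ ((U s : E →L[ℂ] E) x) ((V s : E →L[ℂ] E) x)) 0 s := by
      intro s
      obtain ⟨g1, d1⟩ := hU.hasDerivAt hxy s
      obtain ⟨g2, d2⟩ := hV.hasDerivAt hxy s
      have := d1.inner ℂ d2
      rw [inner_smul_left, inner_smul_right, hsym g1 g2] at this
      simpa using this
    have hc := is_const_of_deriv_eq_zero (fun s => (hd s).differentiableAt)
      (fun s => (hd s).deriv) t 0
    simp only [hU.map_zero, hV.map_zero, OneMemClass.coe_one,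
      one_apply_eq_self] at hc
    have nU : ‖(U t : E →L[ℂ] E) x‖ = ‖x‖ := ContinuousLinearMap.norm_map_of_mem_unitary (U t).2 x
    have nV : ‖(V t : E →L[ℂ] E) x‖ = ‖x‖ := ContinuousLinearMap.norm_map_of_mem_unitary (V t).2 x
    rw [← sub_eq_zero, ← norm_eq_zero, ← sq_eq_zero_iff, @norm_sub_sq ℂ, hc, nU, nV,
      inner_self_eq_norm_sq]
    ring
  funext t
  apply Subtype.ext
  apply ContinuousLinearMap.coeFn_injective
  exact Continuous.ext_on hA.dense_domain (U t : E →L[ℂ] E).continuous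
    (V t : E →L[ℂ] E).continuous fun x hx => key x hx t

open Classical in
/-- The unitary operator `exp (i t A)`, for a selfadjoint and possibly unbounded operator `A`: the
value at time `t` of the strongly continuous unitary group with generator `i A`. (For an `A`
which does not generate such a group the value is `1`.) -/
noncomputable def expI (A : E →ₗ.[ℂ] E) (t : ℝ) : UnitaryGroup E :=
  if h : ∃ U : ℝ → UnitaryGroup E, IsUnitaryGroupOf A U then h.choose t else 1

theorem IsUnitaryGroupOf.expI_eq {A : E →ₗ.[ℂ] E} (hA : IsSelfAdjoint A)
    {U : ℝ → UnitaryGroup E} (hU : IsUnitaryGroupOf A U) (t : ℝ) : expI A t = U t := by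
  have h : ∃ U : ℝ → UnitaryGroup E, IsUnitaryGroupOf A U := ⟨U, hU⟩
  rw [expI, dif_pos h, h.choose_spec.unique hA hU]

/-- The strong (operator) topology on the unitary group: the topology of pointwise convergence
on `ℋ`. -/
noncomputable abbrev strongTopology (E : Type*) [NormedAddCommGroup E] [InnerProductSpace ℂ E] [CompleteSpace E] :
    TopologicalSpace (UnitaryGroup E) :=
  TopologicalSpace.induced (fun (u : UnitaryGroup E) (x : E) => (u : E →L[ℂ] E) x)
    Pi.topologicalSpace

/-- A set of unitaries is strongly closed if it is closed for the strong topology. -/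
def IsStronglyClosed (S : Set (UnitaryGroup E)) : Prop :=
  @IsClosed (UnitaryGroup E) (strongTopology E) S

/-- The smallest strongly closed subgroup of the unitary group containing `S`. -/
noncomputable def stronglyClosedSubgroup (S : Set (UnitaryGroup E)) : Subgroup (UnitaryGroup E) :=
  sInf {K : Subgroup (UnitaryGroup E) | S ⊆ K ∧ IsStronglyClosed (K : Set (UnitaryGroup E))}

theorem stronglyClosedSubgroup_isLeast (S : Set (UnitaryGroup E)) :
    IsLeast {K : Subgroup (UnitaryGroup E) |
      S ⊆ K ∧ IsStronglyClosed (K : Set (UnitaryGroup E))} (stronglyClosedSubgroup S) := by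
  refine ⟨⟨fun u hu => ?_, ?_⟩, fun K hK => sInf_le hK⟩
  · exact Subgroup.mem_sInf.2 fun K hK => hK.1 hu
  · unfold stronglyClosedSubgroup IsStronglyClosed
    rw [Subgroup.coe_sInf]
    let _ : TopologicalSpace (UnitaryGroup E) := strongTopology E
    exact isClosed_biInter fun K hK => hK.2

/-- The operator `H(y) = H₀ + ∑ j, y j • H_j` with domain `D` (a subspace of all the domains of
`H₀, …, H_N`). -/
noncomputable def hamiltonian {N : ℕ} (H : Fin (N + 1) → (E →ₗ.[ℂ] E)) (D : Submodule ℂ E)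
    (y : Fin N → ℝ) : E →ₗ.[ℂ] E :=
  (H 0 + ∑ j : Fin N, (y j : ℂ) • H j.succ).domRestrict D

/-- The dynamical group `𝒢(H₀, …, H_N)`, for `H(y)` essentially selfadjoint on `D`: the smallest
strongly closed subgroup containing all `exp (i t H(y))`. Here `H(y)` in the exponent is the
closure of the operator with domain `D`. -/
noncomputable def dynamicalGroup {N : ℕ} (H : Fin (N + 1) → (E →ₗ.[ℂ] E))
    (D : Submodule ℂ E) : Subgroup (UnitaryGroup E) :=
  stronglyClosedSubgroup {u | ∃ (t : ℝ) (y : Fin N → ℝ), u = expI (hamiltonian H D y).closure t}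

/-- The restricted dynamical group `𝒢̂(H₀, …, H_N)`: the smallest strongly closed subgroup
containing all `exp (i t H_j)`, `j = 0, …, N`. -/
noncomputable def restrictedDynamicalGroup {N : ℕ} (H : Fin (N + 1) → (E →ₗ.[ℂ] E)) :
    Subgroup (UnitaryGroup E) :=
  stronglyClosedSubgroup {u | ∃ (t : ℝ) (j : Fin (N + 1)), u = expI (H j) t}

end QControl

/-!
Two facts about unbounded operators give the theorem.

The first is the existence part of Stone's theorem, `exists_isUnitaryGroupOf`: a selfadjoint `A`
generates a strongly continuous unitary group, so that `expI A` is never the default value. The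
group is the strong limit of `exp (i t Bₙ)`, where the `Bₙ` are the Yosida approximations of `A`,
built from the resolvents `(A ± i c)⁻¹`. They commute, whence
`‖exp (i t Bₘ) x - exp (i t Bₙ) x‖ ≤ |t| ‖Bₘ x - Bₙ x‖`, and they converge to `A` on its domain.

The second is Chernoff's product formula, `tendsto_pow_pow_apply`: if `F` is a curve of unitaries
through the identity with velocity `i A x` at every `x` in a core of `A`, then products of values
of `F` converge strongly to `exp (i t A)`. As the core need not be invariant under the group of
`A`, one cannot compare `F (t / n)` with `exp (i (t / n) A)` along an orbit directly. Instead the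
time `t` is cut into `M` blocks, and each block into `m` steps with `m → ∞` first. Within a block,
`F (δ / m) ^ m` follows the expansion `x + i δ A x` up to `δ² ‖A² x‖` whenever `x` is in the
domain of `A²` (`eventually_norm_pow_apply_sub_sub_le`), and `‖A² x‖` is constant along the orbit,
so the total error is `O(1 / M)`. The domain of `A²` is dense, which gives convergence everywhere.

Call a vector field `B : D → ℋ` tangent to a subgroup if it is the velocity of a curve in the
subgroup (`IsTangent`). The tangent fields form a real vector space, the sum being realized by
products of curves. By the product formula, a strongly closed subgroup contains `exp (i t A)` as
soon as `i A` is tangent to it on a core of `A` (`IsTangent.expI_mem`). Now `i H(y)` is on `D` a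
real linear combination of the `i H_j`, and conversely `H_0 = H(0)` and `H_j = H(e_j) - H(0)` on
`D`, so that each of the two groups contains the generators of the other.
-/

open Filter Topology

namespace QControl

variable {E : Type*} [NormedAddCommGroup E] [InnerProductSpace ℂ E]

/-! ### The Hamiltonians of the control system -/

theorem add_mem_graph_add {f g : E →ₗ.[ℂ] E} {x v w : E} (hf : (x, v) ∈ f.graph)
    (hg : (x, w) ∈ g.graph) : (x, v + w) ∈ (f + g).graph := by
  obtain ⟨a, rfl, rfl⟩ := (LinearPMap.mem_graph_iff f).1 hf
  obtain ⟨b, hb, rfl⟩ := (LinearPMap.mem_graph_iff g).1 hg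
  replace hb : (b : E) = a := hb
  have hab : b = ⟨a, hb ▸ b.2⟩ := Subtype.ext hb
  rw [hab]
  exact LinearPMap.mem_graph (f + g) ⟨a, a.2, hb ▸ b.2⟩

theorem smul_mem_graph_smul {f : E →ₗ.[ℂ] E} {x v : E} (c : ℂ) (hf : (x, v) ∈ f.graph) :
    (x, c • v) ∈ (c • f).graph := by
  obtain ⟨a, rfl, rfl⟩ := (LinearPMap.mem_graph_iff f).1 hf
  exact LinearPMap.mem_graph (c • f) a

theorem sum_mem_graph_sum {ι : Type*} (s : Finset ι) {f : ι → E →ₗ.[ℂ] E} {x : E} {v : ι → E}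
    (h : ∀ i, (x, v i) ∈ (f i).graph) : (x, ∑ i ∈ s, v i) ∈ (∑ i ∈ s, f i).graph := by
  classical
  induction s using Finset.induction_on with
  | empty => exact LinearPMap.mem_graph (0 : E →ₗ.[ℂ] E) ⟨x, trivial⟩
  | insert i s hi ih =>
    rw [Finset.sum_insert hi, Finset.sum_insert hi]
    exact add_mem_graph_add (h i) ih

theorem hamiltonian_mem_graph {N : ℕ} {H : Fin (N + 1) → (E →ₗ.[ℂ] E)} {D : Submodule ℂ E}
    {B : Fin (N + 1) → D → E} (hB : ∀ j (x : D), ((x : E), B j x) ∈ (H j).graph)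
    (y : Fin N → ℝ) (x : D) :
    ((x : E), B 0 x + ∑ j : Fin N, (y j : ℂ) • B j.succ x) ∈ (hamiltonian H D y).graph := by
  have h := add_mem_graph_add (hB 0 x) (sum_mem_graph_sum Finset.univ
    fun j : Fin N => smul_mem_graph_smul (y j : ℂ) (hB j.succ x))
  obtain ⟨a, ha, hv⟩ := (LinearPMap.mem_graph_iff _).1 h
  replace ha : (a : E) = x := ha
  refine (LinearPMap.mem_graph_iff _).2 ⟨⟨x, x.2, ha ▸ a.2⟩, rfl, ?_⟩
  rw [← hv]
  exact LinearPMap.domRestrict_apply ha.symm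

theorem hamiltonian_domain {N : ℕ} {H : Fin (N + 1) → (E →ₗ.[ℂ] E)} {D : Submodule ℂ E}
    {B : Fin (N + 1) → D → E} (hB : ∀ j (x : D), ((x : E), B j x) ∈ (H j).graph)
    (y : Fin N → ℝ) : (hamiltonian H D y).domain = D :=
  le_antisymm inf_le_left fun x hx =>
    LinearPMap.mem_domain_of_mem_graph (hamiltonian_mem_graph hB y ⟨x, hx⟩)

/-! ### Strong convergence of contractions -/

/-- Pointwise convergence of a family of contractions passes from a dense set to the whole space. -/
theorem tendsto_apply_of_dense {ι : Type*} {l : Filter ι} {T : ι → E →L[ℂ] E} {S : E →L[ℂ] E}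
    (hT : ∀ i x, ‖T i x‖ ≤ ‖x‖) (hS : ∀ x, ‖S x‖ ≤ ‖x‖) {s : Set E} (hs : Dense s)
    (h : ∀ x ∈ s, Tendsto (fun i => T i x) l (𝓝 (S x))) (x : E) :
    Tendsto (fun i => T i x) l (𝓝 (S x)) := by
  rw [Metric.tendsto_nhds]
  intro ε hε
  obtain ⟨y, hy, hxy⟩ := Metric.dense_iff.1 hs x (ε / 3) (by positivity)
  rw [Metric.mem_ball, dist_eq_norm] at hy
  filter_upwards [Metric.tendsto_nhds.1 (h y hxy) (ε / 3) (by positivity)] with i hi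
  rw [dist_eq_norm] at hi ⊢
  have h1 : T i x - S x = (T i y - S y) - T i (y - x) + S (y - x) := by
    simp only [map_sub]; abel
  rw [h1]
  calc _ ≤ ‖T i y - S y‖ + ‖T i (y - x)‖ + ‖S (y - x)‖ :=
        (norm_add_le _ _).trans (by gcongr; exact norm_sub_le _ _)
    _ < ε := by linarith [hT i (y - x), hS (y - x)]

/-! ### Resolvents -/

/-- `R` is the bounded resolvent `(A + i c)⁻¹`, described through the graph of `A`. -/
structure IsResolvent (A : E →ₗ.[ℂ] E) (c : ℝ) (R : E →L[ℂ] E) : Prop where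
  mem_graph : ∀ x, (R x, x - (c * Complex.I) • R x) ∈ A.graph
  apply_eq : ∀ {u v : E}, (u, v) ∈ A.graph → R (v + (c * Complex.I) • u) = u

theorem IsResolvent.commute {A : E →ₗ.[ℂ] E} {c d : ℝ} {R S : E →L[ℂ] E}
    (hR : IsResolvent A c R) (hS : IsResolvent A d S) : Commute R S := by
  ext x
  have h1 := hS.mem_graph x
  have h2 := hR.mem_graph (S x)
  change R (S x) = S (R x)
  set w := S x
  set u := R w
  -- With `u = R (S x)`, `h3` says that `A u = S x - i c u` is again in the domain, so that
  -- `x = (A + i d) (A + i c) u` can be rewritten as `(A + i c) (A + i d) u`.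
  have h3 := A.graph.sub_mem h1 (A.graph.smul_mem (c * Complex.I) h2)
  have h4 := A.graph.add_mem h3 (A.graph.smul_mem (d * Complex.I) h2)
  have h5 := hR.apply_eq h4
  have h6 := hS.apply_eq h2
  have h7 : x = (((w, x - (d * Complex.I) • w) - (c * Complex.I) • (u, w - (c * Complex.I) • u)) +
      (d * Complex.I) • (u, w - (c * Complex.I) • u)).2 + (c * Complex.I) •
      (((w, x - (d * Complex.I) • w) - (c * Complex.I) • (u, w - (c * Complex.I) • u)) +
      (d * Complex.I) • (u, w - (c * Complex.I) • u)).1 := by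
    simp only [Prod.snd_add, Prod.snd_sub, Prod.smul_snd, Prod.fst_add, Prod.fst_sub, Prod.smul_fst]
    module
  have h8 : R x = w - (c * Complex.I) • u + (d * Complex.I) • u := by
    rw [h7]; exact h5
  rw [h8, h6]

variable [CompleteSpace E]

/-! ### Graphs of selfadjoint operators -/

theorem mem_graph_iff_of_isSelfAdjoint {A : E →ₗ.[ℂ] E} (hA : IsSelfAdjoint A) {x y : E} :
    (x, y) ∈ A.graph ↔ ∀ a b, (a, b) ∈ A.graph → inner ℂ b x = inner ℂ a y := by
  have h := LinearPMap.adjoint_graph_eq_graph_adjoint hA.dense_domain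
  rw [LinearPMap.isSelfAdjoint_def.1 hA] at h
  conv_lhs => rw [h]
  simp [Submodule.mem_adjoint_iff, sub_eq_zero]

theorem inner_eq_of_mem_graph {A : E →ₗ.[ℂ] E} (hA : IsSelfAdjoint A) {a b x y : E}
    (h : (a, b) ∈ A.graph) (h' : (x, y) ∈ A.graph) : inner ℂ b x = inner ℂ a y :=
  (mem_graph_iff_of_isSelfAdjoint hA).1 h' a b h

theorem closure_eq_of_isSelfAdjoint {A : E →ₗ.[ℂ] E} (hA : IsSelfAdjoint A) : A.closure = A := by
  refine LinearPMap.eq_of_eq_graph ?_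
  rw [← hA.isClosed.isClosable.graph_closure_eq_closure_graph]
  exact IsClosed.submodule_topologicalClosure_eq hA.isClosed

/-! ### Resolvents and Yosida approximation -/

theorem norm_sq_add_I_smul_of_mem_graph {A : E →ₗ.[ℂ] E} (hA : IsSelfAdjoint A) {u v : E}
    (h : (u, v) ∈ A.graph) (c : ℝ) :
    ‖v + (c * Complex.I) • u‖ ^ 2 = ‖v‖ ^ 2 + c ^ 2 * ‖u‖ ^ 2 := by
  have hs := inner_eq_of_mem_graph hA h h
  have him : (inner ℂ v u).im = 0 := by
    have h1 : (starRingEnd ℂ) (inner ℂ v u) = inner ℂ v u := by rw [inner_conj_symm, hs]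
    exact Complex.conj_eq_iff_im.1 h1
  rw [@norm_add_sq ℂ, inner_smul_right, norm_smul, mul_pow]
  simp [him]

theorem exists_isResolvent {A : E →ₗ.[ℂ] E} (hA : IsSelfAdjoint A) {c : ℝ} (hc : c ≠ 0) :
    ∃ R, IsResolvent A c R := by
  let φ : A.graph →L[ℂ] E := ((ContinuousLinearMap.snd ℂ E E) +
    (c * Complex.I) • (ContinuousLinearMap.fst ℂ E E)).comp A.graph.subtypeL
  have hφ : ∀ g : A.graph, φ g = g.1.2 + (c * Complex.I) • g.1.1 := fun g => rfl
  have hcl : IsClosed (A.graph : Set (E × E)) := hA.isClosed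
  have hcompl : CompleteSpace A.graph := hcl.completeSpace_coe
  have hbound : ∀ g : A.graph, ‖g.1.1‖ ≤ |c|⁻¹ * ‖φ g‖ ∧ ‖g.1.2‖ ≤ ‖φ g‖ := by
    intro g
    have h := norm_sq_add_I_smul_of_mem_graph hA g.2 c
    rw [← hφ] at h
    constructor
    · rw [le_inv_mul_iff₀ (abs_pos.2 hc)]
      refine le_of_sq_le_sq ?_ (norm_nonneg _)
      rw [mul_pow, sq_abs]
      nlinarith [sq_nonneg ‖g.1.2‖]
    · refine le_of_sq_le_sq ?_ (norm_nonneg _)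
      nlinarith [mul_nonneg (sq_nonneg c) (sq_nonneg ‖g.1.1‖)]
  have hanti : AntilipschitzWith (max |c|⁻¹ 1).toNNReal φ := by
    refine φ.antilipschitz_of_bound fun g => ?_
    rw [Real.coe_toNNReal _ (le_max_of_le_right zero_le_one)]
    change max ‖g.1.1‖ ‖g.1.2‖ ≤ _
    refine max_le ((hbound g).1.trans ?_) ((hbound g).2.trans ?_)
    · gcongr; exact le_max_left _ _
    · exact le_mul_of_one_le_left (norm_nonneg _) (le_max_right _ _)
  have hrange : LinearMap.range (φ : A.graph →ₗ[ℂ] E) = ⊤ := by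
    have hclr : IsClosed (LinearMap.range (φ : A.graph →ₗ[ℂ] E) : Set E) :=
      hanti.isClosed_range φ.uniformContinuous
    have : CompleteSpace (LinearMap.range (φ : A.graph →ₗ[ℂ] E)) := hclr.completeSpace_coe
    rw [← Submodule.orthogonal_eq_bot_iff, Submodule.eq_bot_iff]
    intro z hz
    rw [Submodule.mem_orthogonal] at hz
    -- A vector orthogonal to the range of `A + i c` is an eigenvector for the eigenvalue `i c`.
    have hz' : (z, (c * Complex.I) • z) ∈ A.graph := by
      rw [mem_graph_iff_of_isSelfAdjoint hA]
      intro a b hab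
      have := hz (φ ⟨(a, b), hab⟩) ⟨_, rfl⟩
      rw [hφ, inner_add_left, inner_smul_left] at this
      simp only [map_mul, Complex.conj_ofReal, Complex.conj_I] at this
      rw [inner_smul_right]
      linear_combination this
    have h0 := norm_sq_add_I_smul_of_mem_graph hA hz' (-c)
    simp only [Complex.ofReal_neg, neg_mul, neg_smul, add_neg_cancel, norm_zero] at h0
    have h1 : 0 < c ^ 2 := by positivity
    have h2 : ‖z‖ ^ 2 = 0 := by
      nlinarith [sq_nonneg ‖z‖, sq_nonneg ‖(c * Complex.I : ℂ) • z‖,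
        mul_nonneg h1.le (sq_nonneg ‖z‖)]
    simpa using h2
  let e := ContinuousLinearEquiv.ofBijective φ (LinearMap.ker_eq_bot.2 hanti.injective) hrange
  have he : ∀ g, e g = φ g := fun g => rfl
  refine ⟨(ContinuousLinearMap.fst ℂ E E).comp (A.graph.subtypeL.comp
    (e.symm : E →L[ℂ] A.graph)), ⟨fun x => ?_, fun {u v} h => ?_⟩⟩
  · have hx := e.apply_symm_apply x
    rw [he, hφ] at hx
    have := (e.symm x).2
    convert! this using 1
    refine Prod.ext rfl ?_
    simp only [ContinuousLinearMap.comp_apply]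
    rw [sub_eq_iff_eq_add]
    exact hx.symm
  · have hx := e.symm_apply_apply ⟨(u, v), h⟩
    change (e.symm (v + (c * Complex.I) • u)).1.1 = u
    rw [he, hφ] at hx
    rw [hx]

namespace IsResolvent

variable {A : E →ₗ.[ℂ] E} {c : ℝ} {R S : E →L[ℂ] E}

theorem norm_apply_le (hA : IsSelfAdjoint A) (hR : IsResolvent A c R) (x : E) :
    |c| * ‖R x‖ ≤ ‖x‖ := by
  have h := norm_sq_add_I_smul_of_mem_graph hA (hR.mem_graph x) c
  rw [sub_add_cancel] at h
  refine le_of_sq_le_sq ?_ (norm_nonneg _)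
  rw [mul_pow, sq_abs, h]
  exact le_add_of_nonneg_left (sq_nonneg _)

theorem adjoint_eq (hA : IsSelfAdjoint A) (hR : IsResolvent A c R) (hS : IsResolvent A (-c) S) :
    ContinuousLinearMap.adjoint R = S := by
  refine ((ContinuousLinearMap.eq_adjoint_iff _ _).2 fun x y => ?_).symm
  have h := inner_eq_of_mem_graph hA (hS.mem_graph x) (hR.mem_graph y)
  rw [inner_sub_left, inner_sub_right, inner_smul_left, inner_smul_right] at h
  simp only [map_mul, Complex.conj_ofReal, Complex.conj_I] at h
  push_cast at h
  linear_combination -h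

end IsResolvent

/-- Yosida approximation: a selfadjoint operator is the strong limit, on its domain, of commuting
bounded selfadjoint operators. -/
theorem exists_bounded_approximation {A : E →ₗ.[ℂ] E} (hA : IsSelfAdjoint A) :
    ∃ B : ℕ → E →L[ℂ] E, (∀ n, IsSelfAdjoint (B n)) ∧ (∀ m n, Commute (B m) (B n)) ∧
      ∀ x y, (x, y) ∈ A.graph → Tendsto (fun n => B n x) atTop (𝓝 y) := by
  have hpos : ∀ n : ℕ, (0 : ℝ) < n + 1 := fun n => by positivity
  choose R hR using fun n : ℕ => exists_isResolvent hA (hpos n).ne'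
  choose S hS using fun n : ℕ => exists_isResolvent hA (neg_ne_zero.2 (hpos n).ne')
  have hRS : ∀ n, ContinuousLinearMap.adjoint (R n) = S n := fun n => (hR n).adjoint_eq hA (hS n)
  have hSR : ∀ n, ContinuousLinearMap.adjoint (S n) = R n := fun n => by
    rw [← hRS, ContinuousLinearMap.adjoint_adjoint]
  -- With `c = n + 1`, this is `c² A (A² + c²)⁻¹ = (c² / 2) ((A + i c)⁻¹ + (A - i c)⁻¹)`.
  refine ⟨fun n => (((n : ℝ) + 1) ^ 2 / 2 : ℝ) • (R n + S n), fun n => ?_, fun m n => ?_,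
    fun x y hxy => ?_⟩
  · refine IsSelfAdjoint.smul (IsSelfAdjoint.all _) ?_
    rw [IsSelfAdjoint, star_add, ContinuousLinearMap.star_eq_adjoint,
      ContinuousLinearMap.star_eq_adjoint, hRS, hSR, add_comm]
  · refine Commute.smul_left (Commute.smul_right ?_ _) _
    exact (((hR m).commute (hR n)).add_right ((hR m).commute (hS n))).add_left
      (((hS m).commute (hR n)).add_right ((hS m).commute (hS n)))
  -- The approximations factor as `P n` after `A`, with contractions `P n` converging strongly to `1`.
  · let P : ℕ → E →L[ℂ] E := fun n => (((n : ℝ) + 1 : ℝ) * Complex.I / 2) • (R n - S n)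
    have hP : ∀ n : ℕ, (((n : ℝ) + 1) ^ 2 / 2 : ℝ) • (R n + S n) x = P n y := by
      intro n
      have h1 := (hR n).apply_eq hxy
      have h2 := (hS n).apply_eq hxy
      rw [map_add, map_smul, ← eq_sub_iff_add_eq] at h1 h2
      simp only [P, smul_apply, sub_apply, h1, h2, add_apply]
      set c : ℝ := (n : ℝ) + 1
      have hI := Complex.I_mul_I
      rw [← Complex.coe_smul]
      push_cast
      rw [show x - ((c : ℂ) * Complex.I) • R n x - (x - (-(c : ℂ) * Complex.I) • S n x) =
        (-(c : ℂ) * Complex.I) • (R n x + S n x) by module, smul_smul]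
      congr 1
      linear_combination (c : ℂ) ^ 2 / 2 * hI
    have hbd : ∀ n z, ‖P n z‖ ≤ ‖z‖ := by
      intro n z
      have h1 := (hR n).norm_apply_le hA z
      have h2 := (hS n).norm_apply_le hA z
      rw [abs_neg] at h2
      simp only [P, smul_apply, sub_apply, norm_smul, norm_mul, norm_div,
        Complex.norm_I, Complex.norm_real, mul_one]
      have h3 := norm_sub_le (R n z) (S n z)
      rw [Real.norm_eq_abs]
      norm_num
      nlinarith [abs_nonneg ((n : ℝ) + 1)]
    have hconv : ∀ z, Tendsto (fun n => P n z) atTop (𝓝 (ContinuousLinearMap.id ℂ E z)) := by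
      refine tendsto_apply_of_dense hbd (fun z => le_rfl) hA.dense_domain fun z hz => ?_
      have hzw := LinearPMap.mem_graph A ⟨z, hz⟩
      set w := A ⟨z, hz⟩
      rw [tendsto_iff_norm_sub_tendsto_zero]
      have hlim : Tendsto (fun n : ℕ => ‖w‖ * (1 / ((n : ℝ) + 1))) atTop (𝓝 0) := by
        simpa using tendsto_one_div_add_atTop_nhds_zero_nat.const_mul ‖w‖
      refine squeeze_zero (fun _ => norm_nonneg _) (fun n => ?_) hlim
      have h1 := (hR n).apply_eq hzw
      have h2 := (hS n).apply_eq hzw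
      rw [map_add, map_smul] at h1 h2
      have h3 := (hR n).norm_apply_le hA w
      have h4 := (hS n).norm_apply_le hA w
      rw [abs_neg] at h4
      have h5 : P n z - ContinuousLinearMap.id ℂ E z = -((1 / 2 : ℂ) • (R n w + S n w)) := by
        simp only [P, smul_apply, sub_apply, ContinuousLinearMap.id_apply]
        push_cast at h1 h2 ⊢
        have h1' : R n w = z - (((n : ℂ) + 1) * Complex.I) • R n z := eq_sub_of_add_eq h1
        have h2' : S n w = z - (-((n : ℂ) + 1) * Complex.I) • S n z := eq_sub_of_add_eq h2
        rw [h1', h2']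
        module
      rw [h5, norm_neg, norm_smul]
      rw [abs_of_pos (hpos n)] at h3 h4
      have h6 := norm_add_le (R n w) (S n w)
      rw [mul_one_div, le_div_iff₀ (hpos n)]
      norm_num
      nlinarith [hpos n]
    exact (hconv y).congr fun n => (hP n).symm

/-! ### Existence of the unitary group of a selfadjoint operator -/

theorem norm_unitary_apply (u : UnitaryGroup E) (x : E) : ‖(u : E →L[ℂ] E) x‖ = ‖x‖ :=
  ContinuousLinearMap.norm_map_of_mem_unitary u.2 x

theorem expUnitary_zero_smul (b : selfAdjoint (E →L[ℂ] E)) :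
    selfAdjoint.expUnitary ((0 : ℝ) • b) = 1 := by
  refine Subtype.ext ?_
  rw [selfAdjoint.expUnitary_coe, selfAdjoint.val_smul, zero_smul, smul_zero,
    NormedSpace.exp_zero, OneMemClass.coe_one]

open selfAdjoint in
theorem hasDerivAt_expUnitary_smul (b : selfAdjoint (E →L[ℂ] E)) (x : E) (t : ℝ) :
    HasDerivAt (fun s : ℝ => (expUnitary (s • b) : E →L[ℂ] E) x)
      (Complex.I • (expUnitary (t • b) : E →L[ℂ] E) ((b : E →L[ℂ] E) x)) t := by
  have h := hasDerivAt_exp_smul_const (𝕂 := ℝ) (Complex.I • (b : E →L[ℂ] E)) t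
  have h2 := (((ContinuousLinearMap.apply ℂ E x).restrictScalars ℝ).hasFDerivAt
    (x := NormedSpace.exp (t • Complex.I • (b : E →L[ℂ] E)))).comp_hasDerivAt t h
  have he : ∀ s : ℝ, (expUnitary (s • b) : E →L[ℂ] E) =
      NormedSpace.exp (s • Complex.I • (b : E →L[ℂ] E)) := by
    intro s
    rw [expUnitary_coe, smul_comm, selfAdjoint.val_smul]
  simp only [he]
  convert! h2 using 1
  simp

open selfAdjoint in
theorem norm_expUnitary_smul_sub_self_le (b : selfAdjoint (E →L[ℂ] E)) (x : E) (t : ℝ) :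
    ‖(expUnitary (t • b) : E →L[ℂ] E) x - x‖ ≤ |t| * ‖(b : E →L[ℂ] E) x‖ := by
  have h := convex_univ.norm_image_sub_le_of_norm_hasDerivWithin_le (𝕜 := ℝ)
    (f := fun s : ℝ => (expUnitary (s • b) : E →L[ℂ] E) x) (x := 0) (y := t)
    (C := ‖(b : E →L[ℂ] E) x‖)
    (fun s _ => (hasDerivAt_expUnitary_smul b x s).hasDerivWithinAt)
    (fun s _ => by rw [norm_smul, norm_unitary_apply]; simp) (Set.mem_univ _) (Set.mem_univ _)
  simpa only [expUnitary_zero_smul, OneMemClass.coe_one, one_apply_eq_self, sub_zero,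
    Real.norm_eq_abs, mul_comm] using h

open selfAdjoint in
theorem norm_expUnitary_smul_sub_le {b c : selfAdjoint (E →L[ℂ] E)}
    (h : Commute (b : E →L[ℂ] E) (c : E →L[ℂ] E)) (x : E) (t : ℝ) :
    ‖(expUnitary (t • b) : E →L[ℂ] E) x - (expUnitary (t • c) : E →L[ℂ] E) x‖ ≤
      |t| * ‖(b : E →L[ℂ] E) x - (c : E →L[ℂ] E) x‖ := by
  have hc : Commute ((t • c : selfAdjoint (E →L[ℂ] E)) : E →L[ℂ] E)
      ((t • (b - c) : selfAdjoint (E →L[ℂ] E)) : E →L[ℂ] E) := by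
    simp only [selfAdjoint.val_smul, AddSubgroup.coe_sub]
    exact ((h.symm.sub_right (Commute.refl _)).smul_right t).smul_left t
  have h1 : expUnitary (t • b) = expUnitary (t • c) * expUnitary (t • (b - c)) := by
    
    rw [← hc.expUnitary_add]
    congr 1
    refine Subtype.ext ?_
    change t • (b : E →L[ℂ] E) = t • (c : E →L[ℂ] E) + t • ((b : E →L[ℂ] E) - (c : E →L[ℂ] E))
    rw [← smul_add, add_sub_cancel]
  have h2 : (expUnitary (t • b) : E →L[ℂ] E) x - (expUnitary (t • c) : E →L[ℂ] E) x =
      (expUnitary (t • c) : E →L[ℂ] E) ((expUnitary (t • (b - c)) : E →L[ℂ] E) x - x) := by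
    rw [h1, map_sub]; rfl
  rw [h2, norm_unitary_apply]
  simpa using norm_expUnitary_smul_sub_self_le (b - c) x t

/-- Pointwise Cauchy sequences of isometries on a dense set are pointwise Cauchy everywhere. -/
theorem cauchySeq_unitary_apply_of_dense {u : ℕ → UnitaryGroup E} {s : Set E} (hs : Dense s)
    (h : ∀ x ∈ s, CauchySeq fun n => (u n : E →L[ℂ] E) x) (x : E) :
    CauchySeq fun n => (u n : E →L[ℂ] E) x := by
  rw [Metric.cauchySeq_iff]
  intro ε hε
  obtain ⟨y, hy, hys⟩ := Metric.dense_iff.1 hs x (ε / 3) (by positivity)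
  rw [Metric.mem_ball, dist_eq_norm] at hy
  obtain ⟨N, hN⟩ := Metric.cauchySeq_iff.1 (h y hys) (ε / 3) (by positivity)
  refine ⟨N, fun m hm n hn => ?_⟩
  have h0 := hN m hm n hn
  rw [dist_eq_norm] at h0 ⊢
  have h1 : (u m : E →L[ℂ] E) x - (u n : E →L[ℂ] E) x =
      ((u m : E →L[ℂ] E) y - (u n : E →L[ℂ] E) y) - (u m : E →L[ℂ] E) (y - x) +
        (u n : E →L[ℂ] E) (y - x) := by
    simp only [map_sub]; abel
  rw [h1]
  calc _ ≤ ‖(u m : E →L[ℂ] E) y - (u n : E →L[ℂ] E) y‖ + ‖(u m : E →L[ℂ] E) (y - x)‖ +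
        ‖(u n : E →L[ℂ] E) (y - x)‖ :=
        (norm_add_le _ _).trans (by gcongr; exact norm_sub_le _ _)
    _ < ε := by rw [norm_unitary_apply, norm_unitary_apply]; linarith

/-- The strong limit of a sequence of one-parameter unitary groups is again one. -/
theorem exists_unitary_limit {u : ℕ → ℝ → UnitaryGroup E} (h0 : ∀ n, u n 0 = 1)
    (hadd : ∀ n s t, u n (s + t) = u n s * u n t)
    (hc : ∀ t x, CauchySeq fun n => (u n t : E →L[ℂ] E) x) :
    ∃ U : ℝ → UnitaryGroup E, U 0 = 1 ∧ (∀ s t, U (s + t) = U s * U t) ∧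
      ∀ t x, Tendsto (fun n => (u n t : E →L[ℂ] E) x) atTop (𝓝 ((U t : E →L[ℂ] E) x)) := by
  choose f hf using fun t x => cauchySeq_tendsto_of_complete (hc t x)
  let V : ℝ → E →L[ℂ] E := fun t =>
    continuousLinearMapOfTendsto (fun n => (u n t : E →L[ℂ] E)) (tendsto_pi_nhds.2 (hf t))
  have hV : ∀ t x, Tendsto (fun n => (u n t : E →L[ℂ] E) x) atTop (𝓝 (V t x)) := hf
  have hVadd : ∀ s t x, V (s + t) x = V s (V t x) := by
    intro s t x
    refine tendsto_nhds_unique (hV (s + t) x) ?_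
    have h1 := hV s (V t x)
    rw [tendsto_iff_norm_sub_tendsto_zero] at h1 ⊢
    have h2 := tendsto_iff_norm_sub_tendsto_zero.1 (hV t x)
    refine squeeze_zero (fun _ => norm_nonneg _) (fun n => ?_) (by simpa using h2.add h1)
    have h3 : (u n (s + t) : E →L[ℂ] E) x - V s (V t x) =
        (u n s : E →L[ℂ] E) ((u n t : E →L[ℂ] E) x - V t x) +
          ((u n s : E →L[ℂ] E) (V t x) - V s (V t x)) := by
      rw [hadd, map_sub]; simp
    rw [h3]
    exact (norm_add_le _ _).trans_eq (by rw [norm_unitary_apply])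
  have hV0 : V 0 = 1 := by
    ext x
    refine tendsto_nhds_unique (hV 0 x) ?_
    simp [h0]
  have hadj : ∀ t, ContinuousLinearMap.adjoint (V t) = V (-t) := by
    intro t
    refine ((ContinuousLinearMap.eq_adjoint_iff _ _).2 fun x y => ?_).symm
    refine tendsto_nhds_unique ((hV (-t) x).inner tendsto_const_nhds)
      (Tendsto.congr (fun n => ?_) (tendsto_const_nhds.inner (hV t y)))
    have h1 : u n t * u n (-t) = 1 := by rw [← hadd, add_neg_cancel, h0]
    have h2 : u n (-t) = star (u n t) := by
      rw [Unitary.star_eq_inv]; exact eq_inv_of_mul_eq_one_right h1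
    rw [h2, Unitary.coe_star, ContinuousLinearMap.star_eq_adjoint,
      ContinuousLinearMap.adjoint_inner_left]
  have hunit : ∀ t, V t ∈ unitary (E →L[ℂ] E) := by
    intro t
    rw [Unitary.mem_iff, ContinuousLinearMap.star_eq_adjoint, hadj, ← hV0]
    constructor
    · ext x
      rw [mul_apply_eq_comp, ← hVadd, neg_add_cancel]
    · ext x
      rw [mul_apply_eq_comp, ← hVadd, add_neg_cancel]
  exact ⟨fun t => ⟨V t, hunit t⟩, Subtype.ext hV0,
    fun s t => Subtype.ext (ContinuousLinearMap.ext (hVadd s t)), hV⟩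

/-- If the orbits of vectors in the domain of a selfadjoint `A` have derivative `i A x` at `0`,
then the group is generated by `A`: its generator is a symmetric extension of `A`. -/
theorem isUnitaryGroupOf_of_hasDerivAt {A : E →ₗ.[ℂ] E} (hA : IsSelfAdjoint A)
    {U : ℝ → UnitaryGroup E} (h0 : U 0 = 1) (hadd : ∀ s t, U (s + t) = U s * U t)
    (hd : ∀ x y, (x, y) ∈ A.graph →
      HasDerivAt (fun t : ℝ => (U t : E →L[ℂ] E) x) (Complex.I • y) 0) :
    IsUnitaryGroupOf A U where
  map_zero := h0
  map_add := hadd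
  continuous x := by
    have hz : ∀ x, Tendsto (fun t : ℝ => (U t : E →L[ℂ] E) x) (𝓝 0) (𝓝 x) := by
      refine tendsto_apply_of_dense (S := ContinuousLinearMap.id ℂ E)
        (fun t x => (norm_unitary_apply _ x).le) (fun _ => le_rfl) hA.dense_domain fun x hx => ?_
      have := (hd _ _ (LinearPMap.mem_graph A ⟨x, hx⟩)).continuousAt.tendsto
      simpa [h0] using this
    rw [continuous_iff_continuousAt]
    intro t
    have h1 : Tendsto (fun s : ℝ => s - t) (𝓝 t) (𝓝 0) := by
      simpa using (continuous_sub_right t).tendsto t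
    refine (((U t : E →L[ℂ] E).continuous.tendsto _).comp ((hz x).comp h1)).congr fun s => ?_
    have h2 : U s = U t * U (s - t) := by rw [← hadd]; congr 1; ring
    simp [h2]
  generator x y := by
    refine ⟨hd x y, fun h => (mem_graph_iff_of_isSelfAdjoint hA).2 fun a b hab => ?_⟩
    have h1 := (hasDerivAt_const (0 : ℝ) a).inner ℂ h
    have h2 : HasDerivAt (fun t : ℝ => (U (-t) : E →L[ℂ] E) a) (-(Complex.I • b)) 0 := by
      have := hd a b hab
      rw [← neg_zero] at this
      simpa [Function.comp_def] using this.scomp (0 : ℝ) (hasDerivAt_neg (0 : ℝ))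
    have h3 := h2.inner ℂ (hasDerivAt_const (0 : ℝ) x)
    have h4 : (fun t : ℝ => inner ℂ ((U (-t) : E →L[ℂ] E) a) x) =
        fun t : ℝ => inner ℂ a ((U t : E →L[ℂ] E) x) := by
      funext t
      have h5 : U t * U (-t) = 1 := by rw [← hadd, add_neg_cancel, h0]
      rw [eq_inv_of_mul_eq_one_right h5, ← Unitary.star_eq_inv, Unitary.coe_star,
        ContinuousLinearMap.star_eq_adjoint, ContinuousLinearMap.adjoint_inner_left]
    rw [h4] at h3
    have h6 := h3.unique h1
    simp only [neg_zero, h0, OneMemClass.coe_one, one_apply_eq_self, inner_neg_left,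
      inner_smul_left, inner_smul_right, Complex.conj_I, inner_zero_left, inner_zero_right,
      zero_add, add_zero, neg_mul, neg_neg] at h6
    exact mul_left_cancel₀ Complex.I_ne_zero h6

/-- Stone's theorem, existence part: every selfadjoint operator generates a strongly continuous
unitary group. -/
theorem exists_isUnitaryGroupOf {A : E →ₗ.[ℂ] E} (hA : IsSelfAdjoint A) :
    ∃ U : ℝ → UnitaryGroup E, IsUnitaryGroupOf A U := by
  obtain ⟨B, hB, hcomm, hlim⟩ := exists_bounded_approximation hA
  let b : ℕ → selfAdjoint (E →L[ℂ] E) := fun n => ⟨B n, hB n⟩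
  let u : ℕ → ℝ → UnitaryGroup E := fun n t => selfAdjoint.expUnitary (t • b n)
  have hle : ∀ m n t x, ‖(u m t : E →L[ℂ] E) x - (u n t : E →L[ℂ] E) x‖ ≤
      |t| * ‖B m x - B n x‖ := fun m n t x => norm_expUnitary_smul_sub_le (hcomm m n) x t
  have hcauchy : ∀ t x, CauchySeq fun n => (u n t : E →L[ℂ] E) x := by
    intro t
    refine cauchySeq_unitary_apply_of_dense hA.dense_domain fun x hx => ?_
    have hx' := (hlim _ _ (LinearPMap.mem_graph A ⟨x, hx⟩)).cauchySeq
    rw [Metric.cauchySeq_iff] at hx' ⊢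
    intro ε hε
    obtain ⟨N, hN⟩ := hx' (ε / (|t| + 1)) (by positivity)
    refine ⟨N, fun m hm n hn => ?_⟩
    have h1 := hN m hm n hn
    rw [dist_eq_norm] at h1 ⊢
    rw [lt_div_iff₀ (by positivity)] at h1
    nlinarith [hle m n t x, norm_nonneg (B m x - B n x)]
  obtain ⟨U, hU0, hUadd, hU⟩ := exists_unitary_limit (u := u) (fun n => expUnitary_zero_smul (b n))
    (fun n s t => by
      have hc : Commute ((s • b n : selfAdjoint (E →L[ℂ] E)) : E →L[ℂ] E)
          ((t • b n : selfAdjoint (E →L[ℂ] E)) : E →L[ℂ] E) := by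
        simp only [selfAdjoint.val_smul]
        exact ((Commute.refl _).smul_right t).smul_left s
      simp only [u]
      rw [← hc.expUnitary_add]
      congr 1
      exact Subtype.ext (add_smul s t (b n : E →L[ℂ] E))) hcauchy
  refine ⟨U, isUnitaryGroupOf_of_hasDerivAt hA hU0 hUadd fun x y hxy => ?_⟩
  have hle' : ∀ n t, ‖(u n t : E →L[ℂ] E) x - (U t : E →L[ℂ] E) x‖ ≤ |t| * ‖B n x - y‖ :=
    fun n t => le_of_tendsto_of_tendsto (tendsto_const_nhds.sub (hU t x)).norm
      ((tendsto_const_nhds.sub (hlim x y hxy)).norm.const_mul |t|)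
      (Eventually.of_forall fun m => hle n m t x)
  rw [hasDerivAt_iff_isLittleO, Asymptotics.isLittleO_iff]
  intro ε hε
  obtain ⟨n, hn⟩ := (Metric.tendsto_nhds.1 (hlim x y hxy) (ε / 4) (by positivity)).exists
  rw [dist_eq_norm] at hn
  have hd := hasDerivAt_expUnitary_smul (b n) x 0
  rw [hasDerivAt_iff_isLittleO, Asymptotics.isLittleO_iff] at hd
  filter_upwards [hd (c := ε / 2) (by positivity)] with t ht
  simp only [sub_zero, expUnitary_zero_smul, OneMemClass.coe_one,
    one_apply_eq_self, hU0, Real.norm_eq_abs] at ht ⊢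
  change ‖(u n t : E →L[ℂ] E) x - x - t • Complex.I • B n x‖ ≤ _ at ht
  have h1 : (U t : E →L[ℂ] E) x - x - t • Complex.I • y =
      ((u n t : E →L[ℂ] E) x - x - t • Complex.I • B n x) -
        ((u n t : E →L[ℂ] E) x - (U t : E →L[ℂ] E) x) + t • Complex.I • (B n x - y) := by
    rw [smul_sub, smul_sub]; abel
  rw [h1]
  calc _ ≤ ‖(u n t : E →L[ℂ] E) x - x - t • Complex.I • B n x‖ +
        ‖(u n t : E →L[ℂ] E) x - (U t : E →L[ℂ] E) x‖ + ‖t • Complex.I • (B n x - y)‖ :=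
        (norm_add_le _ _).trans (by gcongr; exact norm_sub_le _ _)
    _ ≤ ε / 2 * |t| + |t| * ‖B n x - y‖ + |t| * ‖B n x - y‖ := by
        gcongr
        · exact hle' n t
        · simp [norm_smul]
    _ ≤ ε * |t| := by nlinarith [abs_nonneg t]

theorem isUnitaryGroupOf_expI {A : E →ₗ.[ℂ] E} (hA : IsSelfAdjoint A) :
    IsUnitaryGroupOf A (expI A) := by
  obtain ⟨U, hU⟩ := exists_isUnitaryGroupOf hA
  rwa [show expI A = U from funext (hU.expI_eq hA)]

/-! ### Powers of unitary operators -/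

theorem norm_unitary_pow_apply_sub_self_le (T : UnitaryGroup E) (x : E) (k : ℕ) :
    ‖((T ^ k : UnitaryGroup E) : E →L[ℂ] E) x - x‖ ≤ k * ‖(T : E →L[ℂ] E) x - x‖ := by
  induction k with
  | zero => simp
  | succ k ih =>
    have h : ((T ^ (k + 1) : UnitaryGroup E) : E →L[ℂ] E) x - x =
        ((T ^ k : UnitaryGroup E) : E →L[ℂ] E) ((T : E →L[ℂ] E) x - x) +
          (((T ^ k : UnitaryGroup E) : E →L[ℂ] E) x - x) := by
      rw [pow_succ, map_sub, Submonoid.coe_mul, mul_apply_eq_comp]; abel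
    rw [h]
    refine (norm_add_le _ _).trans ?_
    rw [norm_unitary_apply]
    rw [Nat.cast_add_one]
    linarith

/-- The deviation of `T ^ m` from its first-order expansion, in terms of the deviation of `T`
from its own and of the displacement of the velocity `b` by the intermediate powers. -/
theorem norm_unitary_pow_apply_sub_sub_le (T : UnitaryGroup E) (x b : E) (h β : ℝ) (m : ℕ)
    (hβ : ∀ k < m, ‖((T ^ k : UnitaryGroup E) : E →L[ℂ] E) b - b‖ ≤ β) :
    ‖((T ^ m : UnitaryGroup E) : E →L[ℂ] E) x - x - (m * h) • b‖ ≤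
      m * ‖(T : E →L[ℂ] E) x - x - h • b‖ + m * (|h| * β) := by
  induction m with
  | zero => simp
  | succ m ih =>
    have e : ((T ^ (m + 1) : UnitaryGroup E) : E →L[ℂ] E) x - x - ((m + 1 : ℕ) * h) • b =
        ((T ^ m : UnitaryGroup E) : E →L[ℂ] E) ((T : E →L[ℂ] E) x - x - h • b) +
          h • (((T ^ m : UnitaryGroup E) : E →L[ℂ] E) b - b) +
          (((T ^ m : UnitaryGroup E) : E →L[ℂ] E) x - x - (m * h) • b) := by
      rw [pow_succ, map_sub, map_sub, Submonoid.coe_mul, mul_apply_eq_comp,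
        ContinuousLinearMap.map_smul_of_tower]
      push_cast
      module
    rw [e]
    have h1 := ih fun k hk => hβ k (hk.trans (Nat.lt_succ_self m))
    have h2 : ‖h • (((T ^ m : UnitaryGroup E) : E →L[ℂ] E) b - b)‖ ≤ |h| * β := by
      rw [norm_smul, Real.norm_eq_abs]
      gcongr
      exact hβ m (Nat.lt_succ_self m)
    refine (norm_add₃_le).trans ?_
    rw [norm_unitary_apply]
    rw [Nat.cast_add_one]
    linarith

theorem norm_unitary_pow_apply_sub_pow_apply_le (V W : UnitaryGroup E) (x : E) (β : ℝ) (M : ℕ)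
    (hβ : ∀ k < M, ‖(V : E →L[ℂ] E) (((W ^ k : UnitaryGroup E) : E →L[ℂ] E) x) -
      (W : E →L[ℂ] E) (((W ^ k : UnitaryGroup E) : E →L[ℂ] E) x)‖ ≤ β) :
    ‖((V ^ M : UnitaryGroup E) : E →L[ℂ] E) x - ((W ^ M : UnitaryGroup E) : E →L[ℂ] E) x‖ ≤
      M * β := by
  induction M with
  | zero => simp
  | succ M ih =>
    have e : ((V ^ (M + 1) : UnitaryGroup E) : E →L[ℂ] E) x -
        ((W ^ (M + 1) : UnitaryGroup E) : E →L[ℂ] E) x =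
        (V : E →L[ℂ] E) (((V ^ M : UnitaryGroup E) : E →L[ℂ] E) x -
          ((W ^ M : UnitaryGroup E) : E →L[ℂ] E) x) +
        ((V : E →L[ℂ] E) (((W ^ M : UnitaryGroup E) : E →L[ℂ] E) x) -
          (W : E →L[ℂ] E) (((W ^ M : UnitaryGroup E) : E →L[ℂ] E) x)) := by
      rw [pow_succ', pow_succ', Submonoid.coe_mul, Submonoid.coe_mul, mul_apply_eq_comp,
        mul_apply_eq_comp, map_sub]
      abel
    rw [e]
    refine (norm_add_le _ _).trans ?_
    rw [norm_unitary_apply]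
    have h1 := ih fun k hk => hβ k (hk.trans (Nat.lt_succ_self M))
    have h2 := hβ M (Nat.lt_succ_self M)
    rw [Nat.cast_add_one]
    linarith

theorem IsUnitaryGroupOf.pow_eq {A : E →ₗ.[ℂ] E} {U : ℝ → UnitaryGroup E}
    (hU : IsUnitaryGroupOf A U) (s : ℝ) (m : ℕ) : U s ^ m = U (m * s) := by
  induction m with
  | zero => simp [hU.map_zero]
  | succ m ih => rw [pow_succ, ih, ← hU.map_add]; congr 1; push_cast; ring

/-! ### The product formula -/

theorem eventually_mul_norm_sub_le_of_hasDerivAt {F : ℝ → UnitaryGroup E} (h0 : F 0 = 1)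
    {x b : E} (hF : HasDerivAt (fun s : ℝ => (F s : E →L[ℂ] E) x) b 0) (δ : ℝ) {θ : ℝ}
    (hθ : 0 < θ) :
    ∀ᶠ m : ℕ in atTop, m * ‖(F (δ / m) : E →L[ℂ] E) x - x - (δ / m) • b‖ ≤ θ := by
  rw [hasDerivAt_iff_isLittleO, Asymptotics.isLittleO_iff] at hF
  have h1 := hF (c := θ / (|δ| + 1)) (by positivity)
  have h2 : Tendsto (fun m : ℕ => δ / (m : ℝ)) atTop (𝓝 0) := tendsto_const_div_atTop_nhds_zero_nat δ
  filter_upwards [h2.eventually h1, eventually_gt_atTop 0] with m hm hm0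
  simp only [sub_zero, h0, OneMemClass.coe_one, one_apply_eq_self, Real.norm_eq_abs] at hm
  have hm' : (0 : ℝ) < m := Nat.cast_pos.2 hm0
  calc _ ≤ (m : ℝ) * (θ / (|δ| + 1) * |δ / m|) := by gcongr
    _ = θ * (|δ| / (|δ| + 1)) := by
        rw [abs_div, abs_of_pos hm']; field_simp
    _ ≤ θ * 1 := by
        gcongr
        rw [div_le_one (by positivity)]; linarith
    _ = θ := mul_one θ

theorem exists_mem_core_near {A : E →ₗ.[ℂ] E} (hA : IsSelfAdjoint A) {D : Submodule ℂ E}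
    (hD : A.HasCore D) {x y : E} (h : (x, y) ∈ A.graph) {θ : ℝ} (hθ : 0 < θ) :
    ∃ x' ∈ D, ∃ y', (x', y') ∈ A.graph ∧ ‖x - x'‖ < θ ∧ ‖y - y'‖ < θ := by
  have hc : (A.domRestrict D).IsClosable :=
    hA.isClosed.isClosable.leIsClosable LinearPMap.domRestrict_le
  have hg := hc.graph_closure_eq_closure_graph
  rw [hD.closure_eq] at hg
  rw [← hg] at h
  obtain ⟨⟨x', y'⟩, hp, hd⟩ := Metric.mem_closure_iff.1 h θ hθ
  rw [Prod.dist_eq, max_lt_iff, dist_eq_norm, dist_eq_norm] at hd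
  exact ⟨x', (LinearPMap.mem_domain_of_mem_graph hp).1, y',
    LinearPMap.le_graph_of_le LinearPMap.domRestrict_le hp, hd⟩

/-- Over a time `δ`, the powers `F (δ / m) ^ m` move a vector of the domain of `A²` along its
first-order expansion, up to an error of second order in `δ`. Both the vector and its velocity
are approximated by vectors of the core; telescoping keeps the resulting errors bounded
uniformly in `m`. -/
theorem eventually_norm_pow_apply_sub_sub_le {A : E →ₗ.[ℂ] E} (hA : IsSelfAdjoint A)
    {D : Submodule ℂ E} (hD : A.HasCore D) {F : ℝ → UnitaryGroup E} (h0 : F 0 = 1)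
    (hF : ∀ x ∈ D, ∀ y, (x, y) ∈ A.graph →
      HasDerivAt (fun s : ℝ => (F s : E →L[ℂ] E) x) (Complex.I • y) 0)
    {x y z : E} (hxy : (x, y) ∈ A.graph) (hyz : (y, z) ∈ A.graph) (δ : ℝ) {η : ℝ} (hη : 0 < η) :
    ∀ᶠ m : ℕ in atTop, ‖((F (δ / m) ^ m : UnitaryGroup E) : E →L[ℂ] E) x - x -
      δ • Complex.I • y‖ ≤ δ ^ 2 * ‖z‖ + η := by
  set θ := η / (3 + 6 * |δ| + δ ^ 2) with hθ_def
  have hθ : 0 < θ := by positivity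
  obtain ⟨x', hx'D, y', hxy', hx, hy⟩ := exists_mem_core_near hA hD hxy hθ
  obtain ⟨y₂, hy₂D, z', hyz', hy₂, hz⟩ := exists_mem_core_near hA hD hyz hθ
  filter_upwards [eventually_mul_norm_sub_le_of_hasDerivAt h0 (hF x' hx'D y' hxy') δ hθ,
    eventually_mul_norm_sub_le_of_hasDerivAt h0 (hF y₂ hy₂D z' hyz') δ hθ,
    eventually_gt_atTop 0] with m hm1 hm2 hm0
  have hm' : (0 : ℝ) < m := Nat.cast_pos.2 hm0
  set T := F (δ / m)
  have hmh : (m : ℝ) * |δ / m| = |δ| := by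
    rw [abs_div, abs_of_pos hm']; field_simp
  have hz' : ‖z'‖ ≤ ‖z‖ + θ := by
    have := norm_sub_norm_le z' z
    rw [norm_sub_rev] at this
    linarith
  have hyy : ‖y' - y₂‖ ≤ 2 * θ := by
    have : y' - y₂ = (y - y₂) - (y - y') := by abel
    rw [this]
    linarith [norm_sub_le (y - y₂) (y - y')]
  have hTy₂ : m * ‖(T : E →L[ℂ] E) y₂ - y₂‖ ≤ θ + |δ| * (‖z‖ + θ) := by
    have e : (T : E →L[ℂ] E) y₂ - y₂ =
      ((T : E →L[ℂ] E) y₂ - y₂ - (δ / m) • Complex.I • z') + (δ / m) • Complex.I • z' := by abel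
    calc _ ≤ m * (‖(T : E →L[ℂ] E) y₂ - y₂ - (δ / m) • Complex.I • z'‖ + |δ / m| * ‖z'‖) := by
          gcongr
          conv_lhs => rw [e]
          refine (norm_add_le _ _).trans_eq ?_
          rw [norm_smul (δ / (m : ℝ)), norm_smul Complex.I, Complex.norm_I, one_mul,
            Real.norm_eq_abs]
      _ = m * ‖(T : E →L[ℂ] E) y₂ - y₂ - (δ / m) • Complex.I • z'‖ + |δ| * ‖z'‖ := by
          rw [mul_add, ← mul_assoc, hmh]
      _ ≤ _ := by gcongr
  have hβ : ∀ k < m, ‖((T ^ k : UnitaryGroup E) : E →L[ℂ] E) (Complex.I • y') - Complex.I • y'‖ ≤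
      5 * θ + |δ| * (‖z‖ + θ) := by
    intro k hk
    rw [map_smul, ← smul_sub, norm_smul, Complex.norm_I, one_mul]
    have e : ((T ^ k : UnitaryGroup E) : E →L[ℂ] E) y' - y' =
        ((T ^ k : UnitaryGroup E) : E →L[ℂ] E) (y' - y₂) +
        (((T ^ k : UnitaryGroup E) : E →L[ℂ] E) y₂ - y₂) - (y' - y₂) := by
      rw [map_sub]; abel
    rw [e]
    have h1 := norm_unitary_pow_apply_sub_self_le T y₂ k
    have h2 : (k : ℝ) * ‖(T : E →L[ℂ] E) y₂ - y₂‖ ≤ m * ‖(T : E →L[ℂ] E) y₂ - y₂‖ := by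
      gcongr
    have h3 := (norm_sub_le (((T ^ k : UnitaryGroup E) : E →L[ℂ] E) (y' - y₂) +
        (((T ^ k : UnitaryGroup E) : E →L[ℂ] E) y₂ - y₂)) (y' - y₂)).trans
      (add_le_add_left (norm_add_le _ _) _)
    rw [norm_unitary_apply] at h3
    linarith
  have hmain := norm_unitary_pow_apply_sub_sub_le T x' (Complex.I • y') (δ / m) _ m hβ
  rw [mul_div_cancel₀ δ hm'.ne', ← mul_assoc, hmh] at hmain
  have e : ((T ^ m : UnitaryGroup E) : E →L[ℂ] E) x - x - δ • Complex.I • y =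
      ((T ^ m : UnitaryGroup E) : E →L[ℂ] E) (x - x') +
      (((T ^ m : UnitaryGroup E) : E →L[ℂ] E) x' - x' - δ • Complex.I • y') -
      ((x - x') + δ • Complex.I • (y - y')) := by
    rw [map_sub]; module
  have h4 : ‖(x - x') + δ • Complex.I • (y - y')‖ ≤ θ + |δ| * θ := by
    refine (norm_add_le _ _).trans ?_
    rw [norm_smul δ, norm_smul Complex.I, Complex.norm_I, one_mul, Real.norm_eq_abs]
    gcongr
  have h5 := (norm_sub_le (((T ^ m : UnitaryGroup E) : E →L[ℂ] E) (x - x') +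
      (((T ^ m : UnitaryGroup E) : E →L[ℂ] E) x' - x' - δ • Complex.I • y'))
      ((x - x') + δ • Complex.I • (y - y'))).trans (add_le_add_left (norm_add_le _ _) _)
  rw [norm_unitary_apply] at h5
  rw [e]
  have h6 : θ * (3 + 6 * |δ| + δ ^ 2) = η := by
    rw [hθ_def]; field_simp
  have h7 : |δ| * (5 * θ + |δ| * (‖z‖ + θ)) = 5 * |δ| * θ + δ ^ 2 * ‖z‖ + δ ^ 2 * θ := by
    rw [← sq_abs δ]; ring
  linarith

theorem IsUnitaryGroupOf.mem_graph_pow {A : E →ₗ.[ℂ] E} {U : ℝ → UnitaryGroup E}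
    (hU : IsUnitaryGroupOf A U) {x y : E} (h : (x, y) ∈ A.graph) (δ : ℝ) (k : ℕ) :
    (((U δ ^ k : UnitaryGroup E) : E →L[ℂ] E) x, ((U δ ^ k : UnitaryGroup E) : E →L[ℂ] E) y) ∈
      A.graph := by
  rw [hU.pow_eq]
  exact (hU.hasDerivAt h _).1

/-- The domain of the square of a selfadjoint operator is dense. -/
theorem dense_domain_sq {A : E →ₗ.[ℂ] E} (hA : IsSelfAdjoint A) :
    Dense {x : E | ∃ y z, (x, y) ∈ A.graph ∧ (y, z) ∈ A.graph} := by
  obtain ⟨R, hR⟩ := exists_isResolvent hA one_ne_zero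
  have hrange : DenseRange R := hA.dense_domain.mono fun x hx =>
    ⟨_, hR.apply_eq (LinearPMap.mem_graph A ⟨x, hx⟩)⟩
  refine (hrange.comp hrange R.continuous).mono ?_
  rintro _ ⟨x, rfl⟩
  exact ⟨_, _, hR.mem_graph (R x), A.graph.sub_mem (hR.mem_graph x)
    (A.graph.smul_mem _ (hR.mem_graph (R x)))⟩

/-- Chernoff's product formula on the domain of `A²`, with the number of factors `M * m`. -/
theorem eventually_norm_pow_pow_apply_sub_le {A : E →ₗ.[ℂ] E} (hA : IsSelfAdjoint A)
    {U : ℝ → UnitaryGroup E} (hU : IsUnitaryGroupOf A U)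
    {D : Submodule ℂ E} (hD : A.HasCore D) {F : ℝ → UnitaryGroup E} (h0 : F 0 = 1)
    (hF : ∀ x ∈ D, ∀ y, (x, y) ∈ A.graph →
      HasDerivAt (fun s : ℝ => (F s : E →L[ℂ] E) x) (Complex.I • y) 0)
    {x y z : E} (hxy : (x, y) ∈ A.graph) (hyz : (y, z) ∈ A.graph) (t : ℝ) {M : ℕ} (hM : 0 < M) :
    ∀ᶠ m : ℕ in atTop, ‖(((F (t / M / m) ^ m) ^ M : UnitaryGroup E) : E →L[ℂ] E) x -
      (U t : E →L[ℂ] E) x‖ ≤ (2 * t ^ 2 * ‖z‖ + 2) / M := by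
  have hM' : (0 : ℝ) < M := Nat.cast_pos.2 hM
  set δ := t / M with hδ
  have hUt : U δ ^ M = U t := by rw [hU.pow_eq, hδ, mul_div_cancel₀ t hM'.ne']
  have hη : (0 : ℝ) < 1 / (M : ℝ) ^ 2 := by positivity
  have hUF : ∀ x ∈ D, ∀ y, (x, y) ∈ A.graph →
      HasDerivAt (fun s : ℝ => (U s : E →L[ℂ] E) x) (Complex.I • y) 0 :=
    fun x _ y h => (hU.generator x y).1 h
  have hall : ∀ k ∈ Finset.range M, ∀ᶠ m : ℕ in atTop,
      ‖((F (δ / m) ^ m : UnitaryGroup E) : E →L[ℂ] E)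
          (((U δ ^ k : UnitaryGroup E) : E →L[ℂ] E) x) -
        (U δ : E →L[ℂ] E) (((U δ ^ k : UnitaryGroup E) : E →L[ℂ] E) x)‖ ≤
        2 * (δ ^ 2 * ‖z‖ + 1 / (M : ℝ) ^ 2) := by
    intro k _
    have g1 := hU.mem_graph_pow hxy δ k
    have g2 := hU.mem_graph_pow hyz δ k
    -- Both families have the same first-order expansion; for `U` the powers are constant in `m`.
    filter_upwards [eventually_norm_pow_apply_sub_sub_le hA hD h0 hF g1 g2 δ hη,
      eventually_norm_pow_apply_sub_sub_le hA hD hU.map_zero hUF g1 g2 δ hη,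
      eventually_gt_atTop 0] with m h1 h2 hm0
    rw [norm_unitary_apply] at h1 h2
    rw [hU.pow_eq, mul_div_cancel₀ δ (Nat.cast_ne_zero.2 hm0.ne')] at h2
    have h3 := norm_sub_le_norm_sub_add_norm_sub
      (((F (δ / m) ^ m : UnitaryGroup E) : E →L[ℂ] E)
          (((U δ ^ k : UnitaryGroup E) : E →L[ℂ] E) x) -
            ((U δ ^ k : UnitaryGroup E) : E →L[ℂ] E) x)
      (δ • Complex.I • ((U δ ^ k : UnitaryGroup E) : E →L[ℂ] E) y)
      ((U δ : E →L[ℂ] E) (((U δ ^ k : UnitaryGroup E) : E →L[ℂ] E) x) -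
            ((U δ ^ k : UnitaryGroup E) : E →L[ℂ] E) x)
    rw [sub_sub_sub_cancel_right] at h3
    rw [norm_sub_rev] at h2
    linarith
  filter_upwards [(Finset.eventually_all (Finset.range M)).2 hall] with m hm
  have h := norm_unitary_pow_apply_sub_pow_apply_le (F (δ / m) ^ m) (U δ) x _ M
    fun k hk => hm k (Finset.mem_range.2 hk)
  rw [hUt] at h
  refine h.trans_eq ?_
  rw [hδ]
  field_simp

/-- Chernoff's product formula. -/
theorem tendsto_pow_pow_apply {A : E →ₗ.[ℂ] E} (hA : IsSelfAdjoint A)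
    {U : ℝ → UnitaryGroup E} (hU : IsUnitaryGroupOf A U)
    {D : Submodule ℂ E} (hD : A.HasCore D) {F : ℝ → UnitaryGroup E} (h0 : F 0 = 1)
    (hF : ∀ x ∈ D, ∀ y, (x, y) ∈ A.graph →
      HasDerivAt (fun s : ℝ => (F s : E →L[ℂ] E) x) (Complex.I • y) 0) (t : ℝ) (x : E) :
    Tendsto (fun p : ℕ × ℕ => (((F (t / p.1 / p.2) ^ p.2) ^ p.1 : UnitaryGroup E) : E →L[ℂ] E) x)
      (curry atTop atTop) (𝓝 ((U t : E →L[ℂ] E) x)) := by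
  refine tendsto_apply_of_dense (fun p x => (norm_unitary_apply _ x).le)
    (fun x => (norm_unitary_apply _ x).le) (dense_domain_sq hA) ?_ x
  rintro x ⟨y, z, hxy, hyz⟩
  rw [Metric.tendsto_nhds]
  intro ε hε
  rw [eventually_curry_iff]
  have hlim : Tendsto (fun M : ℕ => (2 * t ^ 2 * ‖z‖ + 2) / (M : ℝ)) atTop (𝓝 0) :=
    tendsto_const_div_atTop_nhds_zero_nat _
  filter_upwards [hlim.eventually_lt_const hε, eventually_gt_atTop 0] with M hMε hM
  filter_upwards [eventually_norm_pow_pow_apply_sub_le hA hU hD h0 hF hxy hyz t hM] with m hm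
  rw [dist_eq_norm]
  exact hm.trans_lt hMε

/-! ### Tangent fields of strongly closed subgroups -/

theorem mem_of_isStronglyClosed {K : Subgroup (UnitaryGroup E)}
    (hK : IsStronglyClosed (K : Set (UnitaryGroup E))) {ι : Type*} {l : Filter ι} [l.NeBot]
    {u : ι → UnitaryGroup E} {v : UnitaryGroup E} (hu : ∀ i, u i ∈ K)
    (h : ∀ x, Tendsto (fun i => (u i : E →L[ℂ] E) x) l (𝓝 ((v : E →L[ℂ] E) x))) : v ∈ K := by
  let _ : TopologicalSpace (UnitaryGroup E) := strongTopology E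
  have hv : Tendsto u l (𝓝 v) := by
    rw [nhds_induced, tendsto_comap_iff]
    exact tendsto_pi_nhds.2 h
  exact IsClosed.mem_of_tendsto hK hv (Eventually.of_forall hu)

/-- A vector field `B : D → E` is tangent to the subgroup `K` of the unitary group if it is the
velocity at `0`, on the vectors of `D`, of a curve in `K` through the identity. The curve need not
be a one-parameter group, and is only required to be strongly continuous at `0`. -/
def IsTangent (K : Subgroup (UnitaryGroup E)) (D : Submodule ℂ E) (B : D → E) : Prop :=
  ∃ F : ℝ → UnitaryGroup E, (∀ s, F s ∈ K) ∧ F 0 = 1 ∧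
    (∀ x, Tendsto (fun s => (F s : E →L[ℂ] E) x) (𝓝 0) (𝓝 x)) ∧
    ∀ x : D, HasDerivAt (fun s => (F s : E →L[ℂ] E) x) (B x) 0

namespace IsTangent

variable {K : Subgroup (UnitaryGroup E)} {D : Submodule ℂ E} {B C : D → E}

theorem zero : IsTangent K D 0 :=
  ⟨fun _ => 1, fun _ => K.one_mem, rfl, fun x => by simp,
    fun x => by simpa using hasDerivAt_const (0 : ℝ) (x : E)⟩

/-- The product of two curves has the sum of the velocities. -/
theorem add (hB : IsTangent K D B) (hC : IsTangent K D C) : IsTangent K D (B + C) := by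
  obtain ⟨F, hFK, hF0, hFc, hFd⟩ := hB
  obtain ⟨G, hGK, hG0, hGc, hGd⟩ := hC
  -- Strong continuity is joint on bounded sets: `F s` converges along converging vectors.
  have hjoint : ∀ {l : Filter ℝ} (_ : l ≤ 𝓝 0) {v : ℝ → E} {w : E}, Tendsto v l (𝓝 w) →
      Tendsto (fun s => (F s : E →L[ℂ] E) (v s)) l (𝓝 w) := by
    intro l hl v w hv
    rw [tendsto_iff_norm_sub_tendsto_zero] at hv ⊢
    have h1 := tendsto_iff_norm_sub_tendsto_zero.1 ((hFc w).mono_left hl)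
    refine squeeze_zero (fun _ => norm_nonneg _) (fun s => ?_) (by simpa using hv.add h1)
    have e : (F s : E →L[ℂ] E) (v s) - w =
        (F s : E →L[ℂ] E) (v s - w) + ((F s : E →L[ℂ] E) w - w) := by rw [map_sub]; abel
    rw [e]
    exact (norm_add_le _ _).trans_eq (by rw [norm_unitary_apply])
  refine ⟨fun s => F s * G s, fun s => K.mul_mem (hFK s) (hGK s), by simp [hF0, hG0],
    fun x => hjoint le_rfl (hGc x), fun x => ?_⟩
  have h1 := hasDerivAt_iff_tendsto_slope.1 (hFd x)
  have h2 := hjoint nhdsWithin_le_nhds (hasDerivAt_iff_tendsto_slope.1 (hGd x))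
  rw [hasDerivAt_iff_tendsto_slope]
  refine (h1.add h2).congr fun s => ?_
  simp only [slope_def_module, sub_zero, hF0, hG0, OneMemClass.coe_one,
    one_apply_eq_self, Submonoid.coe_mul, mul_apply_eq_comp]
  rw [ContinuousLinearMap.map_smul_of_tower, map_sub, ← smul_add]
  congr 1
  abel

theorem smul (hB : IsTangent K D B) (c : ℝ) : IsTangent K D (c • B) := by
  obtain ⟨F, hFK, hF0, hFc, hFd⟩ := hB
  refine ⟨fun s => F (c * s), fun s => hFK _, by simp [hF0], fun x => ?_, fun x => ?_⟩
  · refine (hFc x).comp ?_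
    simpa using (continuous_const_mul c).tendsto 0
  · have h := hFd x
    rw [← mul_zero c] at h
    have h1 : HasDerivAt (fun s : ℝ => c * s) c 0 := by
      simpa using (hasDerivAt_id (0 : ℝ)).const_mul c
    exact h.scomp (0 : ℝ) h1

theorem sum {ι : Type*} (s : Finset ι) {B : ι → D → E} (h : ∀ i ∈ s, IsTangent K D (B i)) :
    IsTangent K D (∑ i ∈ s, B i) :=
  Finset.sum_induction B (IsTangent K D) (fun _ _ => add) zero h

/-- A selfadjoint operator whose restriction to a core is tangent to a strongly closed
subgroup generates a one-parameter group in that subgroup. -/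
theorem expI_mem {A : E →ₗ.[ℂ] E} (hA : IsSelfAdjoint A) (hD : A.HasCore D)
    (hK : IsStronglyClosed (K : Set (UnitaryGroup E))) (hB : IsTangent K D B)
    (hAB : ∀ (x : D) (y : E), ((x : E), y) ∈ A.graph → B x = Complex.I • y) (t : ℝ) :
    expI A t ∈ K := by
  obtain ⟨F, hFK, hF0, -, hFd⟩ := hB
  have : (curry (atTop : Filter ℕ) (atTop : Filter ℕ)).NeBot :=
    (frequently_true_iff_neBot _).1 ((frequently_curry_iff fun _ => True).2
      (Eventually.of_forall fun _ => (Eventually.of_forall fun _ => trivial).frequently).frequently)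
  exact mem_of_isStronglyClosed hK
    (fun p : ℕ × ℕ => K.pow_mem (K.pow_mem (hFK (t / p.1 / p.2)) p.2) p.1)
    (tendsto_pow_pow_apply hA (isUnitaryGroupOf_expI hA) hD hF0
      (fun x hx y hxy => hAB ⟨x, hx⟩ y hxy ▸ hFd ⟨x, hx⟩) t)

/-- The generator of a one-parameter group in a subgroup is tangent to that subgroup. -/
theorem of_expI_mem {A : E →ₗ.[ℂ] E} (hA : IsSelfAdjoint A) (hK : ∀ t, expI A t ∈ K)
    (hAB : ∀ x : D, ((x : E), B x) ∈ A.graph) : IsTangent K D (fun x => Complex.I • B x) := by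
  have hU := isUnitaryGroupOf_expI hA
  refine ⟨expI A, hK, hU.map_zero, fun x => ?_, fun x => (hU.generator _ _).1 (hAB x)⟩
  simpa [hU.map_zero] using (hU.continuous x).tendsto 0

end IsTangent

end QControl

/-! ### Equality of the two groups -/

open QControl in
theorem proposition1 {E : Type*} [NormedAddCommGroup E] [InnerProductSpace ℂ E]
    [CompleteSpace E] [TopologicalSpace.SeparableSpace E]
    (N : ℕ) (H : Fin (N + 1) → (E →ₗ.[ℂ] E)) (D : Submodule ℂ E)
    (hH : ∀ j, IsSelfAdjoint (H j))
    (hD : ∀ j, (H j).HasCore D)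
    (hy : ∀ y : Fin N → ℝ, IsSelfAdjoint (QControl.hamiltonian H D y)) :
    QControl.restrictedDynamicalGroup H = QControl.dynamicalGroup H D := by
  let B : Fin (N + 1) → D → E := fun j x => H j ⟨x, (hD j).le_domain x.2⟩
  have hB : ∀ j (x : D), ((x : E), B j x) ∈ (H j).graph := fun j x =>
    LinearPMap.mem_graph (H j) ⟨x, (hD j).le_domain x.2⟩
  let V : (Fin N → ℝ) → D → E := fun y x => B 0 x + ∑ j : Fin N, (y j : ℂ) • B j.succ x
  have hV : ∀ y (x : D), ((x : E), V y x) ∈ (hamiltonian H D y).graph :=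
    fun y x => hamiltonian_mem_graph hB y x
  have hcl : ∀ y, (hamiltonian H D y).closure = hamiltonian H D y :=
    fun y => closure_eq_of_isSelfAdjoint (hy y)
  have hcore : ∀ y, (hamiltonian H D y).HasCore D := fun y => by
    have h := (hamiltonian H D y).closureHasCore
    rwa [hamiltonian_domain hB, hcl] at h
  obtain ⟨⟨hRsub, hRcl⟩, hRle⟩ := stronglyClosedSubgroup_isLeast
    {u : UnitaryGroup E | ∃ (t : ℝ) (j : Fin (N + 1)), u = expI (H j) t}
  obtain ⟨⟨hGsub, hGcl⟩, hGle⟩ := stronglyClosedSubgroup_isLeast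
    {u : UnitaryGroup E | ∃ (t : ℝ) (y : Fin N → ℝ), u = expI (hamiltonian H D y).closure t}
  apply le_antisymm
  · refine hRle ⟨?_, hGcl⟩
    rintro _ ⟨t, j, rfl⟩
    have hT : ∀ y, IsTangent (dynamicalGroup H D) D (fun x => Complex.I • V y x) := fun y =>
      IsTangent.of_expI_mem (hy y) (fun t => hGsub ⟨t, y, by rw [hcl]⟩) (hV y)
    induction j using Fin.cases with
    | zero =>
      refine (hT 0).expI_mem (hH 0) (hD 0) hGcl (fun x y hxy => ?_) t
      rw [LinearPMap.mem_graph_snd_inj _ hxy (hB 0 x) rfl]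
      simp [V]
    | succ j =>
      -- On `D`, the operator `H j` is the difference of `H(e_j)` and `H(0)`.
      refine ((hT (Pi.single j 1)).add ((hT 0).smul (-1))).expI_mem (hH j.succ) (hD j.succ) hGcl
        (fun x y hxy => ?_) t
      rw [LinearPMap.mem_graph_snd_inj _ hxy (hB j.succ x) rfl]
      simp [V, Pi.single_apply]
  · refine hGle ⟨?_, hRcl⟩
    rintro _ ⟨t, y, rfl⟩
    have hT : ∀ j, IsTangent (restrictedDynamicalGroup H) D (fun x => Complex.I • B j x) :=
      fun j => IsTangent.of_expI_mem (hH j) (fun t => hRsub ⟨t, j, rfl⟩) (hB j)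
    rw [hcl]
    refine ((hT 0).add (IsTangent.sum Finset.univ
      fun (j : Fin N) _ => (hT j.succ).smul (y j))).expI_mem (hy y) (hcore y) hRcl
      (fun x z hxz => ?_) t
    rw [LinearPMap.mem_graph_snd_inj _ hxz (hV y x) rfl]
    simp [V, smul_add, Finset.smul_sum, smul_comm Complex.I]
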